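/- Let $n\ge 3$ be odd, put $r_n=1/\cos(\pi/n)$ and $\sigma_n=1/(1+r_n)$, and let the polygon state space $\mathcal S_n\subset\mathbb R^3$ be the convex hull of the points $$s_k=\bigl(r_n\cos\tfrac{2k\pi}{n},\ r_n\sin\tfrac{2k\pi}{n},\ 1\bigr)^T,\qquad k=1,\dots,n.$$ An effect is a linear functional on $\mathbb R^3$ with values in $[0,1]$ on $\mathcal S_n$; effects are identified with vectors of $\mathbb R^3$ through the Euclidean dot product, and the unit effect $u=(0,0,1)^T$ is the one equal to $1$ on $\mathcal S_n$. An observable $\mathsf A$ with finite outcome set $\Omega_{\mathsf A}$ is a family of effects $(\mathsf A_x)_{x\in\Omega_{\mathsf A}}$ with $\sum_x\mathsf A_x=u$. It is a post-processing of an observable $\mathsf J$ if $\mathsf A_x=\sum_{y}\nu_{yx}\mathsf J_y$ for some numbers $\nu_{yx}\in[0,1]$ with $\sum_x\nu_{yx}=1$ for every outcome $y$ of $\mathsf J$. Two observables are compatible if both are post-processings of one common observable. Let $\mathcal T_1$ be the set of trivial observables, i.e. those for which every $\mathsf A_x$ is constant on $\mathcal S_n$, and $\mathcal T_3$ the set of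 observables that are compatible with every observable on $\mathcal S_n$. The noise content of $\mathsf A$ with respect to $\mathcal T_1$ is $$w(\mathsf A;\mathcal T_1)=\sup\{\lambda\in[0,1] : \mathsf A=\lambda\mathsf N+(1-\lambda)\mathsf B \text{ for some } \mathsf N\in\mathcal T_1 \text{ and some observable } \mathsf B\},$$ where $\mathsf N$ and $\mathsf B$ have the same outcome set as $\mathsf A$ and the combination is taken outcome by outcome. Let $\mathsf A$ be an observable on $\mathcal S_n$. (1) If $\mathsf A\in\mathcal T_3$, then $$w(\mathsf A;\mathcal T_1)\ \ge\ 1-r_n\sin\frac{\pi}{2n}\quad\text{if } n=4l+3 \text{ for some } l\in\mathbb N_0,$$ $$w(\mathsf A;\mathcal T_1)\ \ge\ 1-r_n^2\sin\frac{\pi}{2n}\quad\text{if } n=4l+1 \text{ for some } l\in\mathbb N_0.$$ (2) Suppose that all the effects of $\mathsf A$ are non-zero, and write them as $\mathsf A_x=\alpha_x(\vec a_x,\sigma_n)^T$ with $\alpha_x>0$ and $\vec a_x\in\mathbb R^2$. If $$\frac{1-w(\mathsf A;\mathcal T_1)}{\min_{x\in\Omega_{\mathsf A}}\alpha_x}\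 \le\ \sin\frac{\pi}{2n},$$ then $\mathsf A\in\mathcal T_3$. -/

import Mathlib

namespace GPT

universe u v

variable {V : Type v} [AddCommGroup V] [Module ℝ V]

/-- The effects on a state space `S ⊆ V`: the linear functionals on `V` taking values in `[0, 1]`
on all states (no-restriction hypothesis). -/
def effects (S : Set V) : Set (Module.Dual ℝ V) :=
  {e | ∀ s ∈ S, 0 ≤ e s ∧ e s ≤ 1}

/-- An observable on the state space `S` with finite outcome set `Ω`: an effect for each outcome,
adding up to the unit effect, i.e. to the functional which is `1` on every state. -/
structure Observable (S : Set V) (Ω : Type u) [Fintype Ω] where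
  effect : Ω → Module.Dual ℝ V
  effect_mem : ∀ x, effect x ∈ effects S
  sum_eq_one : ∀ s ∈ S, (∑ x, effect x) s = 1

/-- `B` is a post-processing of `A`: there is a right-stochastic matrix `p` such that
`B y = ∑ x, p x y • A x`. -/
def IsPostProcessing {S : Set V} {Ω Ω' : Type u} [Fintype Ω] [Fintype Ω']
    (A : Observable S Ω) (B : Observable S Ω') : Prop :=
  ∃ p : Ω → Ω' → ℝ, (∀ x y, 0 ≤ p x y ∧ p x y ≤ 1) ∧ (∀ x, ∑ y, p x y = 1) ∧
    ∀ y, B.effect y = ∑ x, p x y • A.effect x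

/-- Two observables are compatible if both are post-processings of one (joint) observable with
some finite outcome set. -/
def Compatible {S : Set V} {Ω Ω' : Type u} [Fintype Ω] [Fintype Ω']
    (A : Observable S Ω) (B : Observable S Ω') : Prop :=
  ∃ (Λ : Type u) (_ : Fintype Λ) (J : Observable S Λ),
    IsPostProcessing J A ∧ IsPostProcessing J B

/-- The set `T₁` of trivial observables (with outcome set `Ω`): those assigning the same outcome
distribution to all states. -/
def trivialObs (S : Set V) (Ω : Type u) [Fintype Ω] : Set (Observable S Ω) :=
  {T | ∀ x, ∀ s ∈ S, ∀ s' ∈ S, T.effect x s = T.effect x s'}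

/-- The set `T₃` of observables (with outcome set `Ω`) that are compatible with every observable,
whatever its finite outcome set. -/
def universallyCompatibleObs (S : Set V) (Ω : Type u) [Fintype Ω] : Set (Observable S Ω) :=
  {T | ∀ (Ω' : Type u) [Fintype Ω'] (A : Observable S Ω'), Compatible T A}

/-- The noise content `w(A; N)` of an observable `A` with respect to a noise set `N` (only the noise
observables with the same outcome set as `A` matter): the supremum of all `t ∈ [0, 1]` such that
`A = t N + (1 - t) B` for some `N` in the noise set and some observable `B`. -/
noncomputable def noiseContent {S : Set V} {Ω : Type u} [Fintype Ω]
    (A : Observable S Ω) (noise : Set (Observable S Ω)) : ℝ :=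
  sSup {t : ℝ | t ∈ Set.Icc (0 : ℝ) 1 ∧ ∃ N ∈ noise, ∃ B : Observable S Ω,
    ∀ x, A.effect x = t • N.effect x + (1 - t) • B.effect x}

/-- `r_n = sec (π / n)`. -/
noncomputable def polygonRadius (n : ℕ) : ℝ := 1 / Real.cos (Real.pi / n)

/-- `σ_n = 1 / (1 + r_n)`. -/
noncomputable def polygonHeight (n : ℕ) : ℝ := 1 / (1 + polygonRadius n)

/-- The vertex `s_k = (r_n cos (2kπ/n), r_n sin (2kπ/n), 1)` of the `n`-gon state space. -/
noncomputable def polygonVertex (n k : ℕ) : Fin 3 → ℝ :=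
  ![polygonRadius n * Real.cos (2 * k * Real.pi / n),
    polygonRadius n * Real.sin (2 * k * Real.pi / n), 1]

/-- The regular `n`-gon state space in the plane `z = 1` of `ℝ³`: the convex hull of
`s_1, …, s_n`. -/
noncomputable def polygon (n : ℕ) : Set (Fin 3 → ℝ) :=
  convexHull ℝ (polygonVertex n '' Set.Icc 1 n)

end GPT

/-! Rescale a functional `(x, y, z)` with `z > 0` to height `1`. For odd `n` the positive
functionals then fill the regular `n`-gon inscribed in the unit circle, with the same vertex angles
as the state polygon (`rayEffect_nonneg`, `isConic_of_nonneg`). Its longest diagonals lie at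
distance `sin (π / (2n))` from the centre, and no diagonal comes closer.

Necessity: a vertex and the two ends of its opposite edge, suitably weighted, form an observable.
Its effects are extremal, so every effect compatible with it lies in the cone over that thin
triangle (`nonneg_of_isPostProcessing`). Varying the vertex confines the effects of `A` within all
longest diagonals (`diagonal_bound`), which bounds each effect from below by a multiple of its value
at the centre. That multiple is a trivial observable contained in `A` (`le_noiseContent`).

Sufficiency: the polygon has width at least `1 + r` in every direction, while an effect of `A`
varies by at most `1 - w` (`effect_sub_le`). Hence the rescaled effects lie in the disc of radius
`sin (π / (2n))`, which every triangle of vertices around the centre contains. Any observable `B`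
refines to weighted rays, whose weights split into such triangles. Writing the effects of `A` in
barycentric coordinates of each triangle distributes these weights over the outcomes of `A`
(`exists_distribution`), and this yields a joint observable. -/

namespace GPT

open Real

/-! ### Polar coordinates for states, functionals and vertices. -/

/-- The point of height `1` with polar coordinates `(r, θ)`. -/
noncomputable def polarPoint (r θ : ℝ) : Fin 3 → ℝ := ![r * cos θ, r * sin θ, 1]

/-- The functional `(x, y, z) ↦ x cos θ + y sin θ + z`. -/
noncomputable def rayEffect (θ : ℝ) : Module.Dual ℝ (Fin 3 → ℝ) :=
  cos θ • LinearMap.proj 0 + sin θ • LinearMap.proj 1 + LinearMap.proj 2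

/-- The angle of the `m`-th vertex of the regular `n`-gon. -/
noncomputable def vertexAngle (n : ℕ) (m : ℤ) : ℝ := 2 * m * π / n

theorem rayEffect_apply (θ : ℝ) (v : Fin 3 → ℝ) :
    rayEffect θ v = cos θ * v 0 + sin θ * v 1 + v 2 := by
  simp [rayEffect]

theorem dual_apply (g : Module.Dual ℝ (Fin 3 → ℝ)) (v : Fin 3 → ℝ) :
    g v = g (Pi.single 0 1) * v 0 + g (Pi.single 1 1) * v 1 + g (Pi.single 2 1) * v 2 := by
  rw [LinearMap.pi_apply_eq_sum_univ g v]
  have h : ∀ i : Fin 3, (fun j => if i = j then (1 : ℝ) else 0) = Pi.single i 1 := by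
    intro i; ext j; simp [Pi.single_apply, eq_comm]
  simp only [Fin.sum_univ_three, h, smul_eq_mul]
  ring

theorem dual_apply_polarPoint (g : Module.Dual ℝ (Fin 3 → ℝ)) (r θ : ℝ) :
    g (polarPoint r θ) = r * (g (Pi.single 0 1) * cos θ + g (Pi.single 1 1) * sin θ)
      + g (Pi.single 2 1) := by
  rw [dual_apply]
  simp [polarPoint]
  ring

theorem dual_ext {g h : Module.Dual ℝ (Fin 3 → ℝ)} (h0 : g (Pi.single 0 1) = h (Pi.single 0 1))
    (h1 : g (Pi.single 1 1) = h (Pi.single 1 1)) (h2 : g (Pi.single 2 1) = h (Pi.single 2 1)) :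
    g = h := by
  refine LinearMap.ext fun v => ?_
  rw [dual_apply g, dual_apply h, h0, h1, h2]

theorem rayEffect_single_zero (θ : ℝ) : rayEffect θ (Pi.single 0 1) = cos θ := by
  simp [rayEffect_apply]

theorem rayEffect_single_one (θ : ℝ) : rayEffect θ (Pi.single 1 1) = sin θ := by
  simp [rayEffect_apply]

theorem rayEffect_single_two (θ : ℝ) : rayEffect θ (Pi.single 2 1) = 1 := by
  simp [rayEffect_apply]

theorem rayEffect_polarPoint (φ r θ : ℝ) :
    rayEffect φ (polarPoint r θ) = r * cos (φ - θ) + 1 := by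
  simp [rayEffect_apply, polarPoint, cos_sub]
  ring

theorem polarPoint_congr {r θ θ' : ℝ} (hc : cos θ = cos θ') (hs : sin θ = sin θ') :
    polarPoint r θ = polarPoint r θ' := by
  simp [polarPoint, hc, hs]

theorem rayEffect_congr {θ θ' : ℝ} (hc : cos θ = cos θ') (hs : sin θ = sin θ') :
    rayEffect θ = rayEffect θ' := by
  simp [rayEffect, hc, hs]

theorem vertexAngle_add_mul {n : ℕ} (hn : n ≠ 0) (m t : ℤ) :
    vertexAngle n (m + n * t) = vertexAngle n m + t * (2 * π) := by
  have : (n : ℝ) ≠ 0 := by exact_mod_cast hn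
  simp only [vertexAngle]
  push_cast
  field_simp

theorem polygonVertex_eq (n k : ℕ) :
    polygonVertex n k = polarPoint (polygonRadius n) (vertexAngle n k) := by
  simp [polygonVertex, polarPoint, vertexAngle]

theorem exists_fin_vertexAngle {n : ℕ} (hn : n ≠ 0) (m : ℤ) :
    ∃ k : Fin n, cos (vertexAngle n m) = cos (vertexAngle n (k : ℕ)) ∧
      sin (vertexAngle n m) = sin (vertexAngle n (k : ℕ)) := by
  have h0 : 0 ≤ m % n := Int.emod_nonneg _ (by exact_mod_cast hn)
  have h1 : m % n < n := Int.emod_lt_of_pos _ (by omega)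
  refine ⟨⟨(m % n).toNat, by omega⟩, ?_⟩
  have e : vertexAngle n m = vertexAngle n (m % n) + ((m / n : ℤ) : ℝ) * (2 * π) := by
    rw [← vertexAngle_add_mul hn, Int.emod_add_mul_ediv]
  simp only [Int.toNat_of_nonneg h0]
  rw [e]
  exact ⟨cos_add_int_mul_two_pi _ _, sin_add_int_mul_two_pi _ _⟩

theorem exists_polygonVertex_eq {n : ℕ} (hn : n ≠ 0) (m : ℤ) :
    ∃ k ∈ Set.Icc 1 n, polygonVertex n k = polarPoint (polygonRadius n) (vertexAngle n m) := by
  -- Vertices are numbered from `1` to `n`, residues from `0` to `n - 1`; hence the shift by one.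
  obtain ⟨k, hc, hs⟩ := exists_fin_vertexAngle hn (m - 1)
  refine ⟨k + 1, ⟨by omega, k.2⟩, ?_⟩
  rw [polygonVertex_eq]
  have e : ∀ j : ℤ, vertexAngle n (j + 1) = vertexAngle n j + vertexAngle n 1 := by
    intro j; simp only [vertexAngle]; push_cast; ring
  have e1 : vertexAngle n m = vertexAngle n (m - 1) + vertexAngle n 1 := by
    rw [← e]; congr 1; ring
  have e2 : vertexAngle n ((k + 1 : ℕ) : ℤ) = vertexAngle n (k : ℕ) + vertexAngle n 1 := by
    rw [← e]; norm_cast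
  rw [e1, e2]
  apply polarPoint_congr
  · rw [cos_add, cos_add, hc, hs]
  · rw [sin_add, sin_add, hc, hs]

theorem vertex_mem_polygon {n : ℕ} (hn : n ≠ 0) (m : ℤ) :
    polarPoint (polygonRadius n) (vertexAngle n m) ∈ polygon n := by
  obtain ⟨k, hk, e⟩ := exists_polygonVertex_eq hn m
  rw [← e]
  exact subset_convexHull ℝ _ ⟨k, hk, rfl⟩

theorem le_on_polygon {n : ℕ} (g : Module.Dual ℝ (Fin 3 → ℝ)) (c : ℝ)
    (h : ∀ m : ℤ, c ≤ g (polarPoint (polygonRadius n) (vertexAngle n m))) :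
    ∀ s ∈ polygon n, c ≤ g s := by
  have : polygon n ⊆ {s | c ≤ g s} := by
    refine convexHull_min ?_ (convex_halfSpace_ge g.isLinear c)
    rintro _ ⟨k, -, rfl⟩
    rw [polygonVertex_eq]
    exact h k
  exact this

theorem height_of_mem_polygon {n : ℕ} {s : Fin 3 → ℝ} (hs : s ∈ polygon n) : s 2 = 1 := by
  have h1 := le_on_polygon (n := n) (LinearMap.proj 2) 1 (by simp [polarPoint]) s hs
  have h2 := le_on_polygon (n := n) (-LinearMap.proj 2) (-1) (by simp [polarPoint]) s hs
  simp at h1 h2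
  linarith

/-- An odd multiple of `π / n` stays at distance at least `π / n` from every multiple of `2π`. -/
theorem cos_odd_mul_le {n : ℕ} (hn : n ≠ 0) {q : ℤ} (hq : Odd q) :
    cos (q * π / n) ≤ cos (π / n) := by
  have hn0 : (0 : ℝ) < n := by positivity
  set t := q / (2 * n)
  have e : q = q % (2 * n) + (2 * n) * t := (Int.emod_add_mul_ediv q (2 * n)).symm
  have h0 : 0 ≤ q % (2 * n) := Int.emod_nonneg _ (by omega)
  have h1 : q % (2 * n) < 2 * n := Int.emod_lt_of_pos _ (by omega)
  have hodd : Odd (q % (2 * n)) := by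
    rw [e] at hq
    have : Even ((2 * n) * t : ℤ) := ⟨n * t, by ring⟩
    exact (Int.odd_add.1 hq).2 this
  set p := q % (2 * n)
  have e' : (q : ℝ) * π / n = p * π / n + t * (2 * π) := by
    rw [e]; push_cast; field_simp
  rw [e', cos_add_int_mul_two_pi]
  have hp : 1 ≤ p := by rcases hodd with ⟨w, hw⟩; omega
  have hp2 : p + 1 ≤ 2 * n := by omega
  have hp' : (1 : ℝ) ≤ p := by exact_mod_cast hp
  have hp2' : (p : ℝ) + 1 ≤ 2 * n := by exact_mod_cast hp2
  rcases le_total p n with h | h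
  · have h' : (p : ℝ) ≤ n := by exact_mod_cast h
    apply cos_le_cos_of_nonneg_of_le_pi (by positivity)
    · rw [div_le_iff₀ hn0]; nlinarith [pi_pos]
    · gcongr; nlinarith [pi_pos]
  · have h' : (n : ℝ) ≤ p := by exact_mod_cast h
    have : cos (p * π / n) = cos ((2 * n - p) * π / n) := by
      rw [← cos_two_pi_sub]; congr 1; field_simp
    rw [this]
    apply cos_le_cos_of_nonneg_of_le_pi (by positivity)
    · rw [div_le_iff₀ hn0]; nlinarith [pi_pos]
    · gcongr; nlinarith [pi_pos]

/-- For odd `n`, a shift by `π` turns even multiples of `π / n` into odd ones. In particular no two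
vertices are antipodal. -/
theorem neg_cos_le_cos_vertexAngle {n : ℕ} (hodd : Odd n) (m : ℤ) :
    -cos (π / n) ≤ cos (vertexAngle n m) := by
  have hn : n ≠ 0 := by rintro rfl; simp at hodd
  have hn0 : (n : ℝ) ≠ 0 := by exact_mod_cast hn
  have h := cos_odd_mul_le hn (q := 2 * m - n) (by
    obtain ⟨w, hw⟩ := hodd
    exact ⟨m - w - 1, by rw [hw]; push_cast; ring⟩)
  have e : (((2 * m - n : ℤ) : ℝ)) * π / n = vertexAngle n m - π := by
    simp only [vertexAngle]; push_cast; field_simp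
  rw [e, cos_sub_pi] at h
  linarith

theorem pi_div_pos {n : ℕ} (hn : 3 ≤ n) : 0 < π / n := by
  have : (0 : ℝ) < n := by exact_mod_cast (by omega : 0 < n)
  positivity

theorem pi_div_le {n : ℕ} (hn : 3 ≤ n) : π / n ≤ π / 3 := by
  have : (3 : ℝ) ≤ n := by exact_mod_cast hn
  have := pi_pos
  gcongr

theorem cos_pi_div_pos {n : ℕ} (hn : 3 ≤ n) : 0 < cos (π / n) := by
  have h1 := pi_div_pos hn
  have h2 := pi_div_le hn
  have := pi_pos
  exact cos_pos_of_mem_Ioo ⟨by linarith, by linarith⟩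

theorem sin_pi_div_pos {n : ℕ} (hn : 3 ≤ n) : 0 < sin (π / n) := by
  have h1 := pi_div_pos hn
  have h2 := pi_div_le hn
  have := pi_pos
  exact sin_pos_of_pos_of_lt_pi h1 (by linarith)

theorem cos_pi_div_lt_one {n : ℕ} (hn : 3 ≤ n) : cos (π / n) < 1 := by
  nlinarith [sin_sq_add_cos_sq (π / n), sin_pi_div_pos hn, cos_pi_div_pos hn]

theorem sin_pi_div_two_mul_pos {n : ℕ} (hn : 3 ≤ n) : 0 < sin (π / (2 * n)) := by
  have h1 := pi_div_pos hn
  have h2 := pi_div_le hn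
  have := pi_pos
  have e : π / (2 * n) = π / n / 2 := by ring
  rw [e]
  exact sin_pos_of_pos_of_lt_pi (by linarith) (by linarith)

theorem sin_sq_pi_div_two_mul (n : ℕ) : sin (π / (2 * n)) ^ 2 = (1 - cos (π / n)) / 2 := by
  have e : π / n = 2 * (π / (2 * n)) := by ring
  rw [e, cos_two_mul, sin_sq]
  ring

theorem polygonRadius_mul_cos {n : ℕ} (hn : 3 ≤ n) : polygonRadius n * cos (π / n) = 1 := by
  have := (cos_pi_div_pos hn).ne'
  simp only [polygonRadius]
  field_simp

theorem polygonRadius_pos {n : ℕ} (hn : 3 ≤ n) : 0 < polygonRadius n := by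
  have := cos_pi_div_pos hn
  simp only [polygonRadius]
  positivity

/-! ### Rays of the effect cone and the thin triangle around the centre. -/

theorem rayEffect_nonneg {n : ℕ} (hn : 3 ≤ n) (hodd : Odd n) (m : ℤ) :
    ∀ s ∈ polygon n, 0 ≤ rayEffect (vertexAngle n m) s := by
  refine le_on_polygon _ _ fun k => ?_
  rw [rayEffect_polarPoint]
  have h := neg_cos_le_cos_vertexAngle hodd (m - k)
  have e : vertexAngle n m - vertexAngle n k = vertexAngle n (m - k) := by
    simp only [vertexAngle]; push_cast; ring
  rw [e]
  nlinarith [polygonRadius_pos hn, polygonRadius_mul_cos hn]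

theorem vertexAngle_opposite_left {n : ℕ} (hn : n ≠ 0) {l : ℤ} (hl : (n : ℤ) = 2 * l + 1) (m : ℤ) :
    vertexAngle n (m + l) = vertexAngle n m + π - π / n := by
  have h : (n : ℝ) ≠ 0 := by exact_mod_cast hn
  have e : (n : ℝ) = 2 * l + 1 := by exact_mod_cast hl
  simp only [vertexAngle]
  push_cast
  field_simp
  rw [e]; ring

theorem vertexAngle_opposite_right {n : ℕ} (hn : n ≠ 0) {l : ℤ} (hl : (n : ℤ) = 2 * l + 1)
    (m : ℤ) : vertexAngle n (m + l + 1) = vertexAngle n m + π + π / n := by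
  have h : (n : ℝ) ≠ 0 := by exact_mod_cast hn
  have e : (n : ℝ) = 2 * l + 1 := by exact_mod_cast hl
  simp only [vertexAngle]
  push_cast
  field_simp
  rw [e]; ring

theorem exists_vertexAngle_eq_sub {n : ℕ} (hn : n ≠ 0) (hodd : Odd n) (m : ℤ) :
    ∃ k, vertexAngle n k = vertexAngle n m + π - π / n := by
  obtain ⟨l, hl⟩ := hodd
  exact ⟨m + l, vertexAngle_opposite_left hn (by exact_mod_cast hl) m⟩

theorem exists_vertexAngle_eq_add {n : ℕ} (hn : n ≠ 0) (hodd : Odd n) (m : ℤ) :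
    ∃ k, vertexAngle n k = vertexAngle n m + π + π / n := by
  obtain ⟨l, hl⟩ := hodd
  exact ⟨m + l + 1, vertexAngle_opposite_right hn (by exact_mod_cast hl) m⟩

/-- The weight of the apex in the thin isosceles triangle around the centre. -/
noncomputable def apexWeight (n : ℕ) : ℝ := cos (π / n) / (1 + cos (π / n))

/-- The weight of each base vertex in the thin isosceles triangle around the centre. -/
noncomputable def baseWeight (n : ℕ) : ℝ := 1 / (2 * (1 + cos (π / n)))

theorem apexWeight_pos {n : ℕ} (hn : 3 ≤ n) : 0 < apexWeight n := by
  have := cos_pi_div_pos hn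
  simp only [apexWeight]; positivity

theorem baseWeight_pos {n : ℕ} (hn : 3 ≤ n) : 0 < baseWeight n := by
  have := cos_pi_div_pos hn
  simp only [baseWeight]; positivity

theorem apexWeight_add {n : ℕ} (hn : 3 ≤ n) : apexWeight n + 2 * baseWeight n = 1 := by
  have := cos_pi_div_pos hn
  simp only [baseWeight, apexWeight]; field_simp
  ring

theorem apexWeight_eq {n : ℕ} (hn : 3 ≤ n) :
    apexWeight n = 2 * baseWeight n * cos (π / n) := by
  have := cos_pi_div_pos hn
  simp only [baseWeight, apexWeight]; field_simp

/-- The weights are the barycentric coordinates of the centre in the triangle with apex `θ` and the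
opposite edge as base. -/
theorem triangle_sum {n : ℕ} (hn : 3 ≤ n) (θ : ℝ) :
    apexWeight n • rayEffect θ + baseWeight n • rayEffect (θ + π - π / n)
      + baseWeight n • rayEffect (θ + π + π / n) = LinearMap.proj 2 := by
  have h1 := apexWeight_add hn
  have h2 := apexWeight_eq hn
  have e1 : θ + π - π / n = θ - π / n + π := by ring
  have e2 : θ + π + π / n = θ + π / n + π := by ring
  apply dual_ext
  · simp only [LinearMap.add_apply, LinearMap.smul_apply, rayEffect_single_zero, e1, e2,
      cos_add, cos_sub, smul_eq_mul]
    simp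
    linear_combination cos θ * h2
  · simp only [LinearMap.add_apply, LinearMap.smul_apply, rayEffect_single_one, e1, e2,
      sin_add, sin_sub, smul_eq_mul]
    simp
    linear_combination sin θ * h2
  · simp only [LinearMap.add_apply, LinearMap.smul_apply, rayEffect_single_two, smul_eq_mul]
    simp
    linarith

theorem centre_mem_polygon {n : ℕ} (hn : 3 ≤ n) (hodd : Odd n) :
    (Pi.single 2 1 : Fin 3 → ℝ) ∈ polygon n := by
  have hn0 : n ≠ 0 := by omega
  obtain ⟨k, hk⟩ := exists_vertexAngle_eq_sub hn0 hodd 0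
  obtain ⟨l, hl⟩ := exists_vertexAngle_eq_add hn0 hodd 0
  have h0 : vertexAngle n 0 = 0 := by simp [vertexAngle]
  have hA := vertex_mem_polygon hn0 0
  have hB := vertex_mem_polygon hn0 k
  have hC := vertex_mem_polygon hn0 l
  have hconv : Convex ℝ (polygon n) := convex_convexHull ℝ _
  have hw := apexWeight_add hn
  have hBC := hconv hB hC (a := 1 / 2) (b := 1 / 2) (by norm_num) (by norm_num) (by norm_num)
  have hABC := hconv hA hBC (apexWeight_pos hn).le
    (b := 2 * baseWeight n) (by linarith [baseWeight_pos hn]) hw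
  convert hABC using 1
  have e1 : 0 + π - π / n = π - π / n := by ring
  have e2 : 0 + π + π / n = π / n + π := by ring
  rw [h0] at hk hl
  rw [h0, hk, hl, e1, e2]
  have h2 := apexWeight_eq hn
  ext i
  fin_cases i
  · simp [polarPoint, cos_add_pi, cos_pi_sub]
    linear_combination - polygonRadius n * h2
  · simp [polarPoint, sin_add_pi, sin_pi_sub]
  · simp [polarPoint]
    linarith

theorem eq_proj_of_eq_one {n : ℕ} (hn : 3 ≤ n) (hodd : Odd n) {g : Module.Dual ℝ (Fin 3 → ℝ)}
    (hg : ∀ s ∈ polygon n, g s = 1) : g = LinearMap.proj 2 := by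
  have hn0 : n ≠ 0 := by omega
  have hr := polygonRadius_pos hn
  have hc := hg _ (centre_mem_polygon hn hodd)
  have h0 := hg _ (vertex_mem_polygon hn0 0)
  have h1 := hg _ (vertex_mem_polygon hn0 1)
  have e0 : vertexAngle n 0 = 0 := by simp [vertexAngle]
  have e1 : vertexAngle n 1 = 2 * (π / n) := by simp [vertexAngle]; ring
  rw [dual_apply_polarPoint, e0, hc] at h0
  rw [dual_apply_polarPoint, e1, hc] at h1
  simp at h0 h1
  have ha : g (Pi.single 0 1) = 0 := h0.resolve_left hr.ne'
  have hs : sin (2 * (π / n)) ≠ 0 := by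
    rw [sin_two_mul]
    have := sin_pi_div_pos hn
    have := cos_pi_div_pos hn
    positivity
  have hb : g (Pi.single 1 1) = 0 := by
    have := h1.resolve_left hr.ne'
    rw [ha] at this
    simpa [hs] using this
  apply dual_ext <;> simp [ha, hb, hc]

/-! ### The positive cone is generated by the rays. -/

/-- A functional is conic if it is a combination with nonnegative coefficients of the rays at the
vertex angles. -/
def IsConic (n : ℕ) (g : Module.Dual ℝ (Fin 3 → ℝ)) : Prop :=
  ∃ b : Fin n → ℝ, (∀ k, 0 ≤ b k) ∧ g = ∑ k, b k • rayEffect (vertexAngle n (k : ℕ))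

theorem IsConic.add {n : ℕ} {g h : Module.Dual ℝ (Fin 3 → ℝ)} (hg : IsConic n g)
    (hh : IsConic n h) : IsConic n (g + h) := by
  obtain ⟨b, hb, rfl⟩ := hg
  obtain ⟨c, hc, rfl⟩ := hh
  refine ⟨b + c, fun k => add_nonneg (hb k) (hc k), ?_⟩
  simp [add_smul, Finset.sum_add_distrib]

theorem IsConic.smul {n : ℕ} {g : Module.Dual ℝ (Fin 3 → ℝ)} (hg : IsConic n g) {t : ℝ}
    (ht : 0 ≤ t) : IsConic n (t • g) := by
  obtain ⟨b, hb, rfl⟩ := hg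
  refine ⟨t • b, fun k => mul_nonneg ht (hb k), ?_⟩
  simp [mul_smul, Finset.smul_sum]

theorem isConic_rayEffect {n : ℕ} (hn : n ≠ 0) (m : ℤ) :
    IsConic n (rayEffect (vertexAngle n m)) := by
  obtain ⟨k, hc, hs⟩ := exists_fin_vertexAngle hn m
  refine ⟨Pi.single k 1, fun j => ?_, ?_⟩
  · by_cases h : j = k
    · subst h; simp
    · simp [h]
  · rw [rayEffect_congr hc hs]
    simp [Pi.single_apply]

theorem isConic_proj {n : ℕ} (hn : 3 ≤ n) (hodd : Odd n) : IsConic n (LinearMap.proj 2) := by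
  have hn0 : n ≠ 0 := by omega
  obtain ⟨k, hk⟩ := exists_vertexAngle_eq_sub hn0 hodd 0
  obtain ⟨l, hl⟩ := exists_vertexAngle_eq_add hn0 hodd 0
  rw [← triangle_sum hn (vertexAngle n 0), ← hk, ← hl]
  exact (((isConic_rayEffect hn0 0).smul (apexWeight_pos hn).le).add
    ((isConic_rayEffect hn0 k).smul (baseWeight_pos hn).le)).add
    ((isConic_rayEffect hn0 l).smul (baseWeight_pos hn).le)

/-- Every functional that is nonnegative on the polygon is a conic combination of the rays. -/
theorem isConic_of_nonneg {n : ℕ} (hn : 3 ≤ n) (hodd : Odd n) {g : Module.Dual ℝ (Fin 3 → ℝ)}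
    (hg : ∀ s ∈ polygon n, 0 ≤ g s) : IsConic n g := by
  have hn0 : n ≠ 0 := by omega
  have hC := cos_pi_div_pos hn
  have hS := sin_pi_div_pos hn
  have hr := polygonRadius_mul_cos hn
  have : Nonempty (Fin n) := ⟨⟨0, by omega⟩⟩
  set f : ℤ → ℝ := fun m => g (polarPoint (polygonRadius n) (vertexAngle n m)) with hf
  -- Subtracting the minimal vertex value `μ` times the unit leaves a positive functional vanishing
  -- at vertex `j`. It is a combination of the two rays that vanish there, with coefficients given
  -- by its values at the vertices `j + 1` and `j - 1`.
  obtain ⟨j, hj⟩ := Finite.exists_min (fun k : Fin n => f (k : ℕ))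
  have hmin : ∀ m : ℤ, f (j : ℕ) ≤ f m := by
    intro m
    obtain ⟨k, hc, hs⟩ := exists_fin_vertexAngle hn0 m
    have : f m = f (k : ℕ) := by simp only [hf]; rw [polarPoint_congr hc hs]
    rw [this]; exact hj k
  have hμ : 0 ≤ f (j : ℕ) := hg _ (vertex_mem_polygon hn0 _)
  have hp := hmin ((j : ℕ) + 1)
  have hm := hmin ((j : ℕ) - 1)
  obtain ⟨k, hk⟩ := exists_vertexAngle_eq_sub hn0 hodd (j : ℕ)
  obtain ⟨l, hl⟩ := exists_vertexAngle_eq_add hn0 hodd (j : ℕ)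
  set θ := vertexAngle n (j : ℕ) with hθ
  have ep : vertexAngle n ((j : ℕ) + 1) = θ + 2 * (π / n) := by
    simp only [hθ, vertexAngle]; push_cast; ring
  have em : vertexAngle n ((j : ℕ) - 1) = θ - 2 * (π / n) := by
    simp only [hθ, vertexAngle]; push_cast; ring
  simp only [hf, ep, em, ← hθ] at hp hm hμ
  set r := polygonRadius n
  set μ := g (polarPoint r θ) with hμdef
  set C := cos (π / n)
  set S := sin (π / n)
  set x := g (Pi.single 0 1)
  set y := g (Pi.single 1 1)
  set z := g (Pi.single 2 1)
  have hsc : S ^ 2 + C ^ 2 = 1 := sin_sq_add_cos_sq _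
  have hθ1 : sin θ ^ 2 + cos θ ^ 2 = 1 := sin_sq_add_cos_sq _
  have hμ' : μ = r * (x * cos θ + y * sin θ) + z := by rw [hμdef, dual_apply_polarPoint]
  -- `B` is the tangential component of `g` at vertex `j`; `hrot` gives the radial one.
  set B := -x * sin θ + y * cos θ with hB
  have hrot : x * cos θ + y * sin θ = - C * (z - μ) := by
    linear_combination (-C) * hμ' - (x * cos θ + y * sin θ) * hr
  have hx : x = -C * (z - μ) * cos θ - B * sin θ := by
    linear_combination cos θ * hrot + sin θ * hB - x * hθ1
  have hy : y = -C * (z - μ) * sin θ + B * cos θ := by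
    linear_combination sin θ * hrot - cos θ * hB - y * hθ1
  have c2 : cos (2 * (π / n)) = 2 * C ^ 2 - 1 := cos_two_mul _
  have s2 : sin (2 * (π / n)) = 2 * S * C := sin_two_mul _
  have hp' : 0 ≤ S * (z - μ) + B := by
    rw [dual_apply_polarPoint, cos_add, sin_add, c2, s2] at hp
    have : r * (x * (cos θ * (2 * C ^ 2 - 1) - sin θ * (2 * S * C))
        + y * (sin θ * (2 * C ^ 2 - 1) + cos θ * (2 * S * C))) + z - μ
        = 2 * S * (S * (z - μ) + B) := by
      linear_combination r * (2 * C ^ 2 - 1) * hrot - 2 * S * C * r * hB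
        + (-(2 * C ^ 2 - 1) * (z - μ) + 2 * S * B) * hr - 2 * (z - μ) * hsc
    have h2 : 0 ≤ 2 * S * (S * (z - μ) + B) := by rw [← this]; linarith
    exact nonneg_of_mul_nonneg_right h2 (by positivity)
  have hm' : 0 ≤ S * (z - μ) - B := by
    rw [dual_apply_polarPoint, cos_sub, sin_sub, c2, s2] at hm
    have : r * (x * (cos θ * (2 * C ^ 2 - 1) + sin θ * (2 * S * C))
        + y * (sin θ * (2 * C ^ 2 - 1) - cos θ * (2 * S * C))) + z - μ
        = 2 * S * (S * (z - μ) - B) := by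
      linear_combination r * (2 * C ^ 2 - 1) * hrot + 2 * S * C * r * hB
        + (-(2 * C ^ 2 - 1) * (z - μ) - 2 * S * B) * hr - 2 * (z - μ) * hsc
    have h2 : 0 ≤ 2 * S * (S * (z - μ) - B) := by rw [← this]; linarith
    exact nonneg_of_mul_nonneg_right h2 (by positivity)
  have e1 : θ + π - π / n = θ - π / n + π := by ring
  have e2 : θ + π + π / n = θ + π / n + π := by ring
  have hc1 : cos (θ + π - π / n) = -(cos θ * C + sin θ * S) := by rw [e1, cos_add_pi, cos_sub]
  have hc2 : cos (θ + π + π / n) = -(cos θ * C - sin θ * S) := by rw [e2, cos_add_pi, cos_add]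
  have hs1 : sin (θ + π - π / n) = -(sin θ * C - cos θ * S) := by rw [e1, sin_add_pi, sin_sub]
  have hs2 : sin (θ + π + π / n) = -(sin θ * C + cos θ * S) := by rw [e2, sin_add_pi, sin_add]
  have hdec : g = μ • LinearMap.proj 2
      + ((S * (z - μ) + B) / (2 * S)) • rayEffect (θ + π - π / n)
      + ((S * (z - μ) - B) / (2 * S)) • rayEffect (θ + π + π / n) := by
    apply dual_ext
    · simp only [LinearMap.add_apply, LinearMap.smul_apply, rayEffect_single_zero, hc1, hc2,
        smul_eq_mul, LinearMap.proj_apply]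
      change x = _
      rw [Pi.single_eq_of_ne (by decide), hx]
      field_simp
      ring
    · simp only [LinearMap.add_apply, LinearMap.smul_apply, rayEffect_single_one, hs1, hs2,
        smul_eq_mul, LinearMap.proj_apply]
      change y = _
      rw [Pi.single_eq_of_ne (by decide), hy]
      field_simp
      ring
    · simp only [LinearMap.add_apply, LinearMap.smul_apply, rayEffect_single_two, smul_eq_mul]
      change z = _
      simp
      field_simp
      ring
  rw [hdec, ← hk, ← hl]
  exact (((isConic_proj hn hodd).smul hμ).add
    ((isConic_rayEffect hn0 k).smul (by positivity))).add
    ((isConic_rayEffect hn0 l).smul (by positivity))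

/-! ### Triangles of rays around the centre and distribution of weights. -/

section Triangles

variable {n : ℕ}

/-- The cross product of the `j`-th and the `k`-th unit vector. -/
noncomputable def vertexCross (n : ℕ) (j k : Fin n) : ℝ :=
  cos (vertexAngle n (j : ℕ)) * sin (vertexAngle n (k : ℕ))
    - sin (vertexAngle n (j : ℕ)) * cos (vertexAngle n (k : ℕ))

/-- The (unnormalised) barycentric coordinate of a functional opposite to the edge `j k`. -/
noncomputable def edgeCoord (n : ℕ) (j k : Fin n) (g : Module.Dual ℝ (Fin 3 → ℝ)) : ℝ :=
  g (Pi.single 2 1) * vertexCross n j k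
    - (g (Pi.single 0 1) * (sin (vertexAngle n (k : ℕ)) - sin (vertexAngle n (j : ℕ)))
      - g (Pi.single 1 1) * (cos (vertexAngle n (k : ℕ)) - cos (vertexAngle n (j : ℕ))))

theorem vertexCross_swap (j k : Fin n) : vertexCross n j k = - vertexCross n k j := by
  simp only [vertexCross]; ring

theorem cos_pair_ge (hodd : Odd n) (j k : Fin n) :
    -cos (π / n) ≤ cos (vertexAngle n (j : ℕ)) * cos (vertexAngle n (k : ℕ))
      + sin (vertexAngle n (j : ℕ)) * sin (vertexAngle n (k : ℕ)) := by
  rw [← cos_sub]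
  have e : vertexAngle n (j : ℕ) - vertexAngle n (k : ℕ) = vertexAngle n ((j : ℕ) - (k : ℕ)) := by
    simp only [vertexAngle]; push_cast; ring
  rw [e]
  exact neg_cos_le_cos_vertexAngle hodd _

/-- Parallel unit vectors are equal or opposite, and oddness of `n` excludes the latter. -/
theorem eq_of_vertexCross_eq_zero (hn : 3 ≤ n) (hodd : Odd n) {j k : Fin n}
    (h : vertexCross n j k = 0) : cos (vertexAngle n (k : ℕ)) = cos (vertexAngle n (j : ℕ)) ∧
      sin (vertexAngle n (k : ℕ)) = sin (vertexAngle n (j : ℕ)) := by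
  have hd := cos_pair_ge hodd j k
  have hC := cos_pi_div_lt_one hn
  have h1 := sin_sq_add_cos_sq (vertexAngle n (j : ℕ))
  have h2 := sin_sq_add_cos_sq (vertexAngle n (k : ℕ))
  simp only [vertexCross] at h
  set a := cos (vertexAngle n (j : ℕ))
  set b := sin (vertexAngle n (j : ℕ))
  set c := cos (vertexAngle n (k : ℕ))
  set d := sin (vertexAngle n (k : ℕ))
  have h3 : (a * c + b * d) ^ 2 = 1 := by
    linear_combination (c ^ 2 + d ^ 2) * h1 + h2 - (a * d - b * c) * h
  have h4 : a * c + b * d = 1 := by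
    have h5 : (a * c + b * d - 1) * (a * c + b * d + 1) = 0 := by linear_combination h3
    rcases mul_eq_zero.1 h5 with h | h <;> linarith
  constructor
  · linear_combination a * h4 - c * h1 - b * h
  · linear_combination b * h4 - d * h1 + a * h

/-- Two vertices subtend at most `π - π / n` at the centre, so their chord does not cut the disc of
radius `sin (π / (2n))`. Algebraically this is Cauchy–Schwarz together with `1 + p ≥ 1 - cos (π /
n)`. -/
theorem edgeCoord_nonneg (hn : 3 ≤ n) (hodd : Odd n) {g : Module.Dual ℝ (Fin 3 → ℝ)}
    (h0 : 0 ≤ g (Pi.single 2 1))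
    (hg : g (Pi.single 0 1) ^ 2 + g (Pi.single 1 1) ^ 2
      ≤ (sin (π / (2 * n)) * g (Pi.single 2 1)) ^ 2) {j k : Fin n}
    (hjk : 0 ≤ vertexCross n j k) : 0 ≤ edgeCoord n j k g := by
  have hd := cos_pair_ge hodd j k
  have hC := cos_pi_div_lt_one hn
  have hs := sin_sq_pi_div_two_mul n
  have h1 := sin_sq_add_cos_sq (vertexAngle n (j : ℕ))
  have h2 := sin_sq_add_cos_sq (vertexAngle n (k : ℕ))
  simp only [edgeCoord]
  rw [mul_pow, hs] at hg
  have hX : vertexCross n j k = cos (vertexAngle n (j : ℕ)) * sin (vertexAngle n (k : ℕ))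
    - sin (vertexAngle n (j : ℕ)) * cos (vertexAngle n (k : ℕ)) := rfl
  set X := vertexCross n j k
  set a := cos (vertexAngle n (j : ℕ))
  set b := sin (vertexAngle n (j : ℕ))
  set c := cos (vertexAngle n (k : ℕ))
  set d := sin (vertexAngle n (k : ℕ))
  set x := g (Pi.single 0 1)
  set y := g (Pi.single 1 1)
  set z := g (Pi.single 2 1)
  set p := a * c + b * d with hp
  have hXp : X ^ 2 = (1 - p) * (1 + p) := by
    rw [hX, hp]; linear_combination (c ^ 2 + d ^ 2) * h1 + h2
  have hp1 : p ≤ 1 := by nlinarith [sq_nonneg (a - c), sq_nonneg (b - d)]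
  have hlen : (d - b) ^ 2 + (c - a) ^ 2 = 2 * (1 - p) := by
    rw [hp]; linear_combination h1 + h2
  have hcs : (x * (d - b) - y * (c - a)) ^ 2 ≤ (x ^ 2 + y ^ 2) * (2 * (1 - p)) := by
    rw [← hlen]; nlinarith [sq_nonneg (x * (c - a) + y * (d - b))]
  have hfin : (x * (d - b) - y * (c - a)) ^ 2 ≤ (z * X) ^ 2 := by
    calc _ ≤ (x ^ 2 + y ^ 2) * (2 * (1 - p)) := hcs
      _ ≤ ((1 - cos (π / n)) / 2 * z ^ 2) * (2 * (1 - p)) := by gcongr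
      _ = z ^ 2 * ((1 - p) * (1 - cos (π / n))) := by ring
      _ ≤ z ^ 2 * ((1 - p) * (1 + p)) := by gcongr; linarith
      _ = (z * X) ^ 2 := by rw [← hXp]; ring
  have := le_of_sq_le_sq hfin (mul_nonneg h0 hjk)
  linarith

theorem edgeCoord_sum {Ω : Type*} [Fintype Ω] (A : Ω → Module.Dual ℝ (Fin 3 → ℝ))
    (hA : ∑ x, A x = LinearMap.proj 2) (j k : Fin n) :
    ∑ x, edgeCoord n j k (A x) = vertexCross n j k := by
  have h : ∀ v : Fin 3 → ℝ, ∑ x, A x v = v 2 := by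
    intro v
    rw [← LinearMap.sum_apply, hA]; rfl
  simp only [edgeCoord, Finset.sum_sub_distrib, ← Finset.sum_mul, h]
  simp

theorem edgeCoord_triangle (i j k : Fin n) (g : Module.Dual ℝ (Fin 3 → ℝ)) :
    edgeCoord n j k g • rayEffect (vertexAngle n (i : ℕ))
      + edgeCoord n k i g • rayEffect (vertexAngle n (j : ℕ))
      + edgeCoord n i j g • rayEffect (vertexAngle n (k : ℕ))
      = (vertexCross n j k + vertexCross n k i + vertexCross n i j) • g := by
  apply dual_ext <;>
  simp only [LinearMap.add_apply, LinearMap.smul_apply, rayEffect_single_zero,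
    rayEffect_single_one, rayEffect_single_two, smul_eq_mul, edgeCoord, vertexCross] <;> ring

theorem vertexCross_triangle_cos (i j k : Fin n) :
    vertexCross n j k * cos (vertexAngle n (i : ℕ)) + vertexCross n k i *
      cos (vertexAngle n (j : ℕ)) + vertexCross n i j * cos (vertexAngle n (k : ℕ)) = 0 := by
  simp only [vertexCross]; ring

theorem vertexCross_triangle_sin (i j k : Fin n) :
    vertexCross n j k * sin (vertexAngle n (i : ℕ)) + vertexCross n k i *
      sin (vertexAngle n (j : ℕ)) + vertexCross n i j * sin (vertexAngle n (k : ℕ)) = 0 := by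
  simp only [vertexCross]; ring

theorem sum_mul_vertexCross {β : Fin n → ℝ} (hc : ∑ k : Fin n, β k * cos (vertexAngle n (k : ℕ)) = 0)
    (hs : ∑ k : Fin n, β k * sin (vertexAngle n (k : ℕ)) = 0) (j : Fin n) :
    ∑ k, β k * vertexCross n j k = 0 := by
  have : ∀ k : Fin n, β k * vertexCross n j k
      = cos (vertexAngle n (j : ℕ)) * (β k * sin (vertexAngle n (k : ℕ)))
        - sin (vertexAngle n (j : ℕ)) * (β k * cos (vertexAngle n (k : ℕ))) := by
    intro k; simp only [vertexCross]; ring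
  simp only [this, Finset.sum_sub_distrib, ← Finset.mul_sum, hc, hs]
  ring

/-- The support of a balanced nonzero weight contains a triangle around the centre. -/
theorem exists_triangle (hn : 3 ≤ n) (hodd : Odd n) {β : Fin n → ℝ} (hβ : ∀ k, 0 ≤ β k)
    (hc : ∑ k : Fin n, β k * cos (vertexAngle n (k : ℕ)) = 0)
    (hs : ∑ k : Fin n, β k * sin (vertexAngle n (k : ℕ)) = 0) (hne : ∃ i, β i ≠ 0) :
    ∃ i j k, 0 < β i ∧ 0 < β j ∧ 0 < β k ∧ 0 < vertexCross n i j ∧ 0 < vertexCross n j k ∧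
      0 < vertexCross n k i := by
  obtain ⟨i, hi⟩ := hne
  have hi : 0 < β i := lt_of_le_of_ne (hβ i) hi.symm
  have hX := sum_mul_vertexCross hc hs
  have hself : ∀ j : Fin n, vertexCross n j j = 0 := fun j => by simp only [vertexCross]; ring
  -- If no weight lay strictly to the left of `i`, balance would put all of it in the direction of
  -- `i`, and the sum could not vanish.
  obtain ⟨j, hj, hij⟩ : ∃ j, 0 < β j ∧ 0 < vertexCross n i j := by
    by_contra! H
    have hle : ∀ k ∈ Finset.univ, β k * vertexCross n i k ≤ 0 := by
      intro k _
      rcases (hβ k).eq_or_lt with h | h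
      · simp [← h]
      · exact mul_nonpos_of_nonneg_of_nonpos h.le (H k h)
    have hz := (Finset.sum_eq_zero_iff_of_nonpos hle).1 (hX i)
    have hpar : ∀ k, β k * cos (vertexAngle n (k : ℕ)) = β k * cos (vertexAngle n (i : ℕ)) ∧
        β k * sin (vertexAngle n (k : ℕ)) = β k * sin (vertexAngle n (i : ℕ)) := by
      intro k
      rcases mul_eq_zero.1 (hz k (Finset.mem_univ k)) with h | h
      · simp [h]
      · obtain ⟨h1, h2⟩ := eq_of_vertexCross_eq_zero hn hodd h
        rw [h1, h2]; exact ⟨rfl, rfl⟩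
    simp only [fun k => (hpar k).1, ← Finset.sum_mul] at hc
    simp only [fun k => (hpar k).2, ← Finset.sum_mul] at hs
    have hpos : 0 < ∑ k, β k :=
      Finset.sum_pos' (fun k _ => hβ k) ⟨i, Finset.mem_univ i, hi⟩
    have h1 := (mul_eq_zero.1 hc).resolve_left hpos.ne'
    have h2 := (mul_eq_zero.1 hs).resolve_left hpos.ne'
    have := sin_sq_add_cos_sq (vertexAngle n (i : ℕ))
    rw [h1, h2] at this
    norm_num at this
  by_contra! H
  -- Sum the balance relations over the open half-plane `L` left of `i`. The part inside `L` cancels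
  -- by skew symmetry; without a triangle all terms from `L` to its complement are nonpositive,
  -- hence zero, yet the pair `(j, i)` contributes a negative term.
  set L := Finset.univ.filter fun k => 0 < vertexCross n i k with hL
  have htot : ∑ a ∈ L, β a * ∑ k, β k * vertexCross n a k = 0 := by simp [hX]
  have hskew : ∑ a ∈ L, β a * ∑ k ∈ L, β k * vertexCross n a k = 0 := by
    have e : ∑ a ∈ L, β a * ∑ k ∈ L, β k * vertexCross n a k
        = -∑ a ∈ L, β a * ∑ k ∈ L, β k * vertexCross n a k := by
      conv_lhs => simp only [Finset.mul_sum]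
      rw [Finset.sum_comm, ← Finset.sum_neg_distrib]
      refine Finset.sum_congr rfl fun a _ => ?_
      rw [Finset.mul_sum, ← Finset.sum_neg_distrib]
      refine Finset.sum_congr rfl fun b _ => ?_
      rw [vertexCross_swap b a]; ring
    linarith
  have hsplit : ∑ a ∈ L, β a * ∑ k ∈ Lᶜ, β k * vertexCross n a k = 0 := by
    have : ∀ a, ∑ k, β k * vertexCross n a k = ∑ k ∈ L, β k * vertexCross n a k
        + ∑ k ∈ Lᶜ, β k * vertexCross n a k := fun a => (Finset.sum_add_sum_compl L _).symm
    simp only [this, mul_add, Finset.sum_add_distrib, hskew] at htot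
    linarith
  have hterm : ∀ a ∈ L, ∀ k ∈ Lᶜ, β a ≠ 0 → β k * vertexCross n a k ≤ 0 := by
    intro a ha k hk hane
    have ha' : 0 < vertexCross n i a := by simpa [hL] using ha
    have hk' : vertexCross n i k ≤ 0 := by simpa [hL] using hk
    have hapos := lt_of_le_of_ne (hβ a) hane.symm
    rcases (hβ k).eq_or_lt with h | h
    · simp [← h]
    refine mul_nonpos_of_nonneg_of_nonpos h.le ?_
    rcases hk'.eq_or_lt with h0 | h0
    · obtain ⟨h1, h2⟩ := eq_of_vertexCross_eq_zero hn hodd h0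
      have : vertexCross n a k = - vertexCross n i a := by
        simp only [vertexCross, h1, h2]; ring
      linarith
    · by_contra! h3
      have := H i a k hi hapos h ha' h3
      rw [vertexCross_swap] at this
      linarith
  have hrow : ∀ a ∈ L, β a * ∑ k ∈ Lᶜ, β k * vertexCross n a k ≤ 0 := by
    intro a ha
    by_cases h : β a = 0
    · simp [h]
    · exact mul_nonpos_of_nonneg_of_nonpos (hβ a)
        (Finset.sum_nonpos fun k hk => hterm a ha k hk h)
  have hjL : j ∈ L := by simp [hL, hij]
  have hiL : i ∈ Lᶜ := by simp [hL, hself]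
  have h1 := (Finset.sum_eq_zero_iff_of_nonpos hrow).1 hsplit j hjL
  have h2 := (mul_eq_zero.1 h1).resolve_left hj.ne'
  have h3 := (Finset.sum_eq_zero_iff_of_nonpos
    (fun k hk => hterm j hjL k hk hj.ne')).1 h2 i hiL
  rw [vertexCross_swap] at h3
  nlinarith [mul_pos hi hij]

/-- Rotating the triangle makes `i` the vertex with the smallest ratio of weight to barycentric
weight. Removing that multiple of the triangle exhausts `i` and keeps all weights nonnegative. -/
theorem exists_minimal_triangle (hn : 3 ≤ n) (hodd : Odd n) {β : Fin n → ℝ} (hβ : ∀ k, 0 ≤ β k)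
    (hc : ∑ k : Fin n, β k * cos (vertexAngle n (k : ℕ)) = 0)
    (hs : ∑ k : Fin n, β k * sin (vertexAngle n (k : ℕ)) = 0) (hne : ∃ i, β i ≠ 0) :
    ∃ i j k, 0 < β i ∧ 0 < vertexCross n i j ∧ 0 < vertexCross n j k ∧ 0 < vertexCross n k i ∧
      β i / vertexCross n j k * vertexCross n k i ≤ β j ∧
      β i / vertexCross n j k * vertexCross n i j ≤ β k := by
  obtain ⟨i, j, k, hi, hj, hk, hij, hjk, hki⟩ := exists_triangle hn hodd hβ hc hs hne
  rcases le_total (β i / vertexCross n j k) (β j / vertexCross n k i) with h1 | h1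
  · rcases le_total (β i / vertexCross n j k) (β k / vertexCross n i j) with h2 | h2
    · exact ⟨i, j, k, hi, hij, hjk, hki, (le_div_iff₀ hki).1 h1, (le_div_iff₀ hij).1 h2⟩
    · exact ⟨k, i, j, hk, hki, hij, hjk, (le_div_iff₀ hjk).1 h2,
        (le_div_iff₀ hki).1 (h2.trans h1)⟩
  · rcases le_total (β j / vertexCross n k i) (β k / vertexCross n i j) with h2 | h2
    · exact ⟨j, k, i, hj, hjk, hki, hij, (le_div_iff₀ hij).1 h2, (le_div_iff₀ hjk).1 h1⟩
    · exact ⟨k, i, j, hk, hki, hij, hjk, (le_div_iff₀ hjk).1 (h2.trans h1),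
        (le_div_iff₀ hki).1 h2⟩

/-- Functionals in the inner disc, adding up to the unit, arise from every balanced weight on the
rays by distributing the weight. -/
theorem exists_distribution (hn : 3 ≤ n) (hodd : Odd n) {Ω : Type*} [Fintype Ω]
    {A : Ω → Module.Dual ℝ (Fin 3 → ℝ)} (hsum : ∑ x, A x = LinearMap.proj 2)
    (h0 : ∀ x, 0 ≤ A x (Pi.single 2 1))
    (hA : ∀ x, A x (Pi.single 0 1) ^ 2 + A x (Pi.single 1 1) ^ 2
      ≤ (sin (π / (2 * n)) * A x (Pi.single 2 1)) ^ 2) (N : ℕ) :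
    ∀ β : Fin n → ℝ, (Finset.univ.filter fun k => β k ≠ 0).card ≤ N → (∀ k, 0 ≤ β k) →
      ∑ k : Fin n, β k * cos (vertexAngle n (k : ℕ)) = 0 →
      ∑ k : Fin n, β k * sin (vertexAngle n (k : ℕ)) = 0 →
      ∃ q : Fin n → Ω → ℝ, (∀ k x, 0 ≤ q k x) ∧ (∀ k, ∑ x, q k x = β k) ∧
        ∀ x, ∑ k : Fin n, q k x • rayEffect (vertexAngle n (k : ℕ)) = (∑ k, β k) • A x := by
  classical
  induction N with
  | zero =>
    intro β hN _ _ _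
    have hz : ∀ k, β k = 0 := by
      simpa [Finset.filter_eq_empty_iff] using hN
    exact ⟨fun _ _ => 0, fun _ _ => le_rfl, fun k => by simp [hz], fun x => by simp [hz]⟩
  | succ N ih =>
    intro β hN hβ hc hs
    by_cases hne : ∃ i, β i ≠ 0
    swap
    · push Not at hne
      exact ⟨fun _ _ => 0, fun _ _ => le_rfl, fun k => by simp [hne], fun x => by simp [hne]⟩
    obtain ⟨i, j, k, hi, hij, hjk, hki, hlej, hlek⟩ :=
      exists_minimal_triangle hn hodd hβ hc hs hne
    have hself : ∀ j : Fin n, vertexCross n j j = 0 := fun j => by simp only [vertexCross]; ring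
    have nij : i ≠ j := by rintro rfl; simp [hself] at hij
    have njk : j ≠ k := by rintro rfl; simp [hself] at hjk
    have nki : k ≠ i := by rintro rfl; simp [hself] at hki
    set t := β i / vertexCross n j k with ht
    have htpos : 0 < t := by positivity
    set tri : ℝ → ℝ → ℝ → Fin n → ℝ := fun a b c m =>
      (if m = i then a else 0) + (if m = j then b else 0) + (if m = k then c else 0) with htri
    have htrisum : ∀ (a b c : ℝ) (f : Fin n → ℝ),
        ∑ m, tri a b c m * f m = a * f i + b * f j + c * f k := by
      intro a b c f
      simp [htri, add_mul, Finset.sum_add_distrib, ite_mul]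
    have htrismul : ∀ (a b c : ℝ) (f : Fin n → Module.Dual ℝ (Fin 3 → ℝ)),
        ∑ m, tri a b c m • f m = a • f i + b • f j + c • f k := by
      intro a b c f
      simp [htri, add_smul, Finset.sum_add_distrib, ite_smul]
    have htrinonneg : ∀ a b c : ℝ, 0 ≤ a → 0 ≤ b → 0 ≤ c → ∀ m, 0 ≤ tri a b c m := by
      intro a b c ha hb hc m
      simp only [htri]
      split_ifs <;> positivity
    set γ := tri (vertexCross n j k) (vertexCross n k i) (vertexCross n i j) with hγ
    have hti : t * vertexCross n j k = β i := div_mul_cancel₀ _ hjk.ne'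
    have hsub : ∀ m, 0 ≤ β m - t * γ m := by
      intro m
      simp only [hγ, htri]
      by_cases hmi : m = i
      · subst hmi; simp [nij, nki.symm, hti]
      by_cases hmj : m = j
      · subst hmj; simp [hmi, njk]; exact hlej
      by_cases hmk : m = k
      · subst hmk; simp [hmi, hmj]; exact hlek
      simp [hmi, hmj, hmk, hβ m]
    have hγi : t * γ i = β i := by simp [hγ, htri, nij, nki.symm, hti]
    have hγ0 : ∀ m, 0 ≤ γ m := htrinonneg _ _ _ hjk.le hki.le hij.le
    -- Removing `t • γ` preserves balance and drops `i` from the support, so the induction applies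
    -- to the rest.
    obtain ⟨q, hq0, hq1, hq2⟩ := ih (fun m => β m - t * γ m) (by
        have : (Finset.univ.filter fun m => β m - t * γ m ≠ 0)
            ⊂ Finset.univ.filter fun m => β m ≠ 0 := by
          refine (Finset.ssubset_iff_of_subset ?_).2 ⟨i, by simp [hi.ne'], by simp [hγi]⟩
          intro m hm
          simp only [Finset.mem_filter, Finset.mem_univ, true_and] at hm ⊢
          intro h
          have h1 := hsub m
          have h2 := mul_nonneg htpos.le (hγ0 m)
          exact hm (by linarith)
        have := Finset.card_lt_card this
        omega) hsub
      (by
        simp only [sub_mul, Finset.sum_sub_distrib, hc, mul_assoc, ← Finset.mul_sum, hγ,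
          htrisum, vertexCross_triangle_cos]
        ring)
      (by
        simp only [sub_mul, Finset.sum_sub_distrib, hs, mul_assoc, ← Finset.mul_sum, hγ,
          htrisum, vertexCross_triangle_sin]
        ring)
    have hW := fun x {j k : Fin n} (h : 0 < vertexCross n j k) =>
      edgeCoord_nonneg hn hodd (h0 x) (hA x) h.le
    -- The removed triangle is divided among the outcomes by the barycentric coordinates of `A x`;
    -- they add up to `γ` because the `A x` add up to the unit.
    refine ⟨fun m x => q m x + t * tri (edgeCoord n j k (A x)) (edgeCoord n k i (A x))
      (edgeCoord n i j (A x)) m, ?_, ?_, ?_⟩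
    · intro m x
      have := htrinonneg _ _ _ (hW x hjk) (hW x hki) (hW x hij) m
      have := hq0 m x
      positivity
    · intro m
      have hsumtri : ∑ x, tri (edgeCoord n j k (A x)) (edgeCoord n k i (A x))
          (edgeCoord n i j (A x)) m = γ m := by
        simp only [htri, hγ, Finset.sum_add_distrib]
        congr 1
        · congr 1 <;> split_ifs <;> simp [edgeCoord_sum A hsum]
        · split_ifs <;> simp [edgeCoord_sum A hsum]
      rw [Finset.sum_add_distrib, hq1, ← Finset.mul_sum, hsumtri]
      ring
    · intro x
      have hγs : ∑ m, γ m = vertexCross n j k + vertexCross n k i + vertexCross n i j := by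
        simpa using htrisum (vertexCross n j k) (vertexCross n k i) (vertexCross n i j) 1
      simp only [add_smul, Finset.sum_add_distrib, hq2, mul_smul, ← Finset.smul_sum, htrismul,
        edgeCoord_triangle]
      rw [Finset.sum_sub_distrib, ← Finset.mul_sum, hγs]
      module

end Triangles

/-! ### Joint observables from their marginals. -/

section General

universe u v

variable {V : Type v} [AddCommGroup V] [Module ℝ V] {S : Set V}

/-- Nonnegative functionals adding up to the unit on the state space form an observable. -/
noncomputable def Observable.ofNonneg {Ω : Type u} [Fintype Ω] (G : Ω → Module.Dual ℝ V)
    (hG : ∀ x, ∀ s ∈ S, 0 ≤ G x s) (hsum : ∀ s ∈ S, (∑ x, G x) s = 1) : Observable S Ω where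
  effect := G
  effect_mem x s hs := by
    refine ⟨hG x s hs, ?_⟩
    rw [← hsum s hs, LinearMap.sum_apply]
    exact Finset.single_le_sum (fun y _ => hG y s hs) (Finset.mem_univ x)
  sum_eq_one := hsum

theorem compatible_of_joint {Ω Ω' : Type u} [Fintype Ω] [Fintype Ω'] {A : Observable S Ω}
    {B : Observable S Ω'} (G : Ω → Ω' → Module.Dual ℝ V) (hG : ∀ x y, ∀ s ∈ S, 0 ≤ G x y s)
    (hA : ∀ x, A.effect x = ∑ y, G x y) (hB : ∀ y, B.effect y = ∑ x, G x y) :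
    Compatible A B := by
  classical
  refine ⟨Ω × Ω', inferInstance, Observable.ofNonneg (fun z => G z.1 z.2)
    (fun z => hG z.1 z.2) ?_, ?_, ?_⟩
  · intro s hs
    rw [← A.sum_eq_one s hs, Fintype.sum_prod_type]
    simp only [hA]
  · refine ⟨fun z x => if z.1 = x then 1 else 0, ?_, ?_, ?_⟩
    · intro z x
      dsimp only
      split_ifs <;> norm_num
    · intro z; simp
    · intro x
      rw [hA, Fintype.sum_prod_type]
      simp [Observable.ofNonneg, ite_smul]
  · refine ⟨fun z y => if z.2 = y then 1 else 0, ?_, ?_, ?_⟩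
    · intro z x
      dsimp only
      split_ifs <;> norm_num
    · intro z; simp
    · intro y
      rw [hB, Fintype.sum_prod_type]
      simp [Observable.ofNonneg, ite_smul]

end General

/-! ### Constraints from compatibility with thin triangles. -/

section Necessary

variable {n : ℕ}

theorem eq_smul_rayEffect (hn : 3 ≤ n) {g : Module.Dual ℝ (Fin 3 → ℝ)} {φ : ℝ}
    (h1 : g (polarPoint (polygonRadius n) (φ + π - π / n)) = 0)
    (h2 : g (polarPoint (polygonRadius n) (φ + π + π / n)) = 0) :
    g = g (Pi.single 2 1) • rayEffect φ := by
  have e1 : φ + π - π / n = φ - π / n + π := by ring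
  have e2 : φ + π + π / n = φ + π / n + π := by ring
  have hr := polygonRadius_mul_cos hn
  have hr0 := polygonRadius_pos hn
  have hS := sin_pi_div_pos hn
  have hφ := sin_sq_add_cos_sq φ
  rw [dual_apply_polarPoint, e1, cos_add_pi, sin_add_pi, cos_sub, sin_sub] at h1
  rw [dual_apply_polarPoint, e2, cos_add_pi, sin_add_pi, cos_add, sin_add] at h2
  set x := g (Pi.single 0 1)
  set y := g (Pi.single 1 1)
  set z := g (Pi.single 2 1)
  have hrot : x * cos φ + y * sin φ = z := by
    linear_combination -(h1 + h2) / 2 - (x * cos φ + y * sin φ) * hr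
  have hperp : -x * sin φ + y * cos φ = 0 := by
    have : 2 * polygonRadius n * sin (π / n) * (-x * sin φ + y * cos φ) = 0 := by
      linear_combination h1 - h2
    exact (mul_eq_zero.1 this).resolve_left (by positivity)
  apply dual_ext
  · simp only [LinearMap.smul_apply, rayEffect_single_zero, smul_eq_mul]
    change x = _
    linear_combination cos φ * hrot - sin φ * hperp - x * hφ
  · simp only [LinearMap.smul_apply, rayEffect_single_one, smul_eq_mul]
    change y = _
    linear_combination sin φ * hrot + cos φ * hperp - y * hφ
  · simp [rayEffect_single_two, z]

theorem rayEffect_opposite (hn : 3 ≤ n) (φ : ℝ) :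
    rayEffect φ (polarPoint (polygonRadius n) (φ + π - π / n)) = 0 ∧
      rayEffect φ (polarPoint (polygonRadius n) (φ + π + π / n)) = 0 := by
  have hr := polygonRadius_mul_cos hn
  constructor
  · rw [rayEffect_polarPoint, show φ - (φ + π - π / n) = π / n - π by ring, cos_sub_pi]
    linarith
  · rw [rayEffect_polarPoint, show φ - (φ + π + π / n) = -(π / n + π) by ring, cos_neg, cos_add_pi]
    linarith

/-- The rays of the effect cone are extremal. -/
theorem eq_smul_of_le_smul_rayEffect (hn : 3 ≤ n) (hodd : Odd n) {g : Module.Dual ℝ (Fin 3 → ℝ)}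
    {m : ℤ} {w : ℝ} (h0 : ∀ s ∈ polygon n, 0 ≤ g s)
    (hle : ∀ s ∈ polygon n, g s ≤ (w • rayEffect (vertexAngle n m)) s) :
    ∃ c : ℝ, 0 ≤ c ∧ g = c • rayEffect (vertexAngle n m) := by
  have hn0 : n ≠ 0 := by omega
  obtain ⟨k, hk⟩ := exists_vertexAngle_eq_sub hn0 hodd m
  obtain ⟨l, hl⟩ := exists_vertexAngle_eq_add hn0 hodd m
  obtain ⟨hz1, hz2⟩ := rayEffect_opposite hn (vertexAngle n m)
  have hsk := vertex_mem_polygon hn0 k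
  have hsl := vertex_mem_polygon hn0 l
  rw [hk] at hsk
  rw [hl] at hsl
  refine ⟨g (Pi.single 2 1), h0 _ (centre_mem_polygon hn hodd), eq_smul_rayEffect hn ?_ ?_⟩
  · refine le_antisymm ((hle _ hsk).trans ?_) (h0 _ hsk)
    simp [hz1]
  · refine le_antisymm ((hle _ hsl).trans ?_) (h0 _ hsl)
    simp [hz2]

/-- Each piece `q i y • J i` lies below an extremal effect `B y`, hence is a multiple of its ray. So
`J i`, and with it `A x`, lies in the cone of the rays of `B`; here `v` need not be a state. -/
theorem nonneg_of_isPostProcessing {Ω Λ Δ : Type*} [Fintype Ω] [Fintype Λ] [Fintype Δ]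
    (hn : 3 ≤ n) (hodd : Odd n) {J : Observable (polygon n) Λ} {A : Observable (polygon n) Ω}
    {B : Observable (polygon n) Δ} (hA : ∃ p : Λ → Ω → ℝ, (∀ i x, 0 ≤ p i x) ∧
      ∀ x, A.effect x = ∑ i, p i x • J.effect i)
    (hB : ∃ q : Λ → Δ → ℝ, (∀ i y, 0 ≤ q i y) ∧ (∀ i, ∑ y, q i y = 1) ∧
      ∀ y, B.effect y = ∑ i, q i y • J.effect i) {v : Fin 3 → ℝ}
    (hrank : ∀ y, ∃ (m : ℤ) (w : ℝ), B.effect y = w • rayEffect (vertexAngle n m) ∧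
      0 ≤ rayEffect (vertexAngle n m) v) (x : Ω) : 0 ≤ A.effect x v := by
  obtain ⟨p, hp, hpA⟩ := hA
  obtain ⟨q, hq, hq1, hqB⟩ := hB
  have hpos : ∀ i y, ∀ s ∈ polygon n, 0 ≤ (q i y • J.effect i) s := fun i y s hs =>
    mul_nonneg (hq i y) ((J.effect_mem i s hs).1)
  have key : ∀ i y, 0 ≤ (q i y • J.effect i) v := by
    intro i y
    obtain ⟨m, w, hw, hv⟩ := hrank y
    obtain ⟨c, hc, e⟩ := eq_smul_of_le_smul_rayEffect (w := w) hn hodd (hpos i y) (by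
      intro s hs
      rw [← hw, hqB, LinearMap.sum_apply]
      exact Finset.single_le_sum (f := fun i => (q i y • J.effect i) s)
        (fun i _ => hpos i y s hs) (Finset.mem_univ i))
    rw [e]
    exact mul_nonneg hc hv
  have hJ : ∀ i, 0 ≤ J.effect i v := by
    intro i
    have : J.effect i v = ∑ y, (q i y • J.effect i) v := by
      simp [← Finset.sum_mul, hq1]
    rw [this]
    exact Finset.sum_nonneg fun y _ => key i y
  rw [hpA, LinearMap.sum_apply]
  exact Finset.sum_nonneg fun i _ => mul_nonneg (hp i x) (hJ i)

/-- Effects of a universally compatible observable lie inside the longest diagonals. -/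
theorem diagonal_bound {Ω : Type*} [Fintype Ω] (hn : 3 ≤ n) (hodd : Odd n)
    {A : Observable (polygon n) Ω} (hA : A ∈ universallyCompatibleObs (polygon n) Ω) (m : ℤ)
    (x : Ω) {δ : ℝ} (hδ : δ = vertexAngle n m + π / 2 - π / (2 * n)) :
    A.effect x (Pi.single 0 1) * cos δ + A.effect x (Pi.single 1 1) * sin δ
      ≤ sin (π / (2 * n)) * A.effect x (Pi.single 2 1) := by
  have hn0 : n ≠ 0 := by omega
  obtain ⟨k, hk⟩ := exists_vertexAngle_eq_sub hn0 hodd m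
  obtain ⟨l, hl⟩ := exists_vertexAngle_eq_add hn0 hodd m
  set θ := vertexAngle n m
  have hwa := apexWeight_pos hn
  have hwb := baseWeight_pos hn
  -- `ULift` places the three outcomes in the universe of `Ω`, over which universal compatibility
  -- quantifies.
  let B : Observable (polygon n) (ULift (Fin 3)) := Observable.ofNonneg
    (fun y => ![apexWeight n • rayEffect (vertexAngle n m),
      baseWeight n • rayEffect (vertexAngle n k), baseWeight n • rayEffect (vertexAngle n l)] y.down)
    (by
      rintro ⟨y⟩ s hs
      have h1 := rayEffect_nonneg hn hodd m s hs
      have h2 := rayEffect_nonneg hn hodd k s hs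
      have h3 := rayEffect_nonneg hn hodd l s hs
      fin_cases y <;> simp <;> positivity)
    (by
      intro s hs
      have e : ∀ f : Fin 3 → Module.Dual ℝ (Fin 3 → ℝ),
          ∑ y : ULift (Fin 3), f y.down = f 0 + f 1 + f 2 := by
        intro f
        rw [← Fin.sum_univ_three]
        exact Fintype.sum_equiv Equiv.ulift _ _ fun _ => rfl
      rw [e]
      simp only [Matrix.cons_val_zero, Matrix.cons_val_one, Matrix.cons_val]
      rw [hk, hl, triangle_sum hn]
      exact height_of_mem_polygon hs)
  obtain ⟨Λ, _, J, ⟨p, hp, -, hpA⟩, ⟨q, hq, hq1, hqB⟩⟩ := hA _ B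
  -- This `v` vanishes on the rays `m` and `k`, so it cuts along their diagonal, whose normal
  -- direction `δ` bisects their angles; on the ray `l` it is nonnegative.
  have h := nonneg_of_isPostProcessing hn hodd (v := ![-cos δ, -sin δ, sin (π / (2 * n))])
    ⟨p, fun i x => (hp i x).1, hpA⟩ ⟨q, fun i y => (hq i y).1, hq1, hqB⟩ (by
      set ε := π / (2 * n) with hε
      have e : π / n = 2 * ε := by rw [hε]; ring
      have hval : ∀ ψ, rayEffect ψ ![-cos δ, -sin δ, sin ε] = sin ε - cos (ψ - δ) := by
        intro ψ
        rw [rayEffect_apply, cos_sub]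
        simp
        ring
      rintro ⟨y⟩
      fin_cases y
      · refine ⟨m, apexWeight n, rfl, ?_⟩
        rw [hval, show vertexAngle n m - δ = -(π / 2 - ε) by rw [hδ]; ring, cos_neg,
          cos_pi_div_two_sub]
        simp
      · refine ⟨k, baseWeight n, rfl, ?_⟩
        rw [hval, hk, show θ + π - π / n - δ = π / 2 - ε by rw [hδ, e]; ring,
          cos_pi_div_two_sub]
        simp
      · refine ⟨l, baseWeight n, rfl, ?_⟩
        rw [hval, hl, show θ + π + π / n - δ = 3 * ε + π / 2 by rw [hδ, e]; ring,
          cos_add_pi_div_two]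
        have h1 := pi_div_pos hn
        have h2 := pi_div_le hn
        have h3 : 0 ≤ sin (3 * ε) := sin_nonneg_of_nonneg_of_le_pi (by linarith) (by linarith)
        have h4 := sin_pi_div_two_mul_pos hn
        linarith) x
  rw [dual_apply] at h
  simp at h
  linarith

end Necessary

/-! ### Noise content and variation of effects. -/

section Noise

variable {n : ℕ} {Ω : Type*} [Fintype Ω]

theorem sum_effect_eq_proj (hn : 3 ≤ n) (hodd : Odd n) (A : Observable (polygon n) Ω) :
    ∑ x, A.effect x = LinearMap.proj 2 :=
  eq_proj_of_eq_one hn hodd A.sum_eq_one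

/-- The trivial observable with the outcome distribution of `A` at the centre. -/
noncomputable def centreObservable (hn : 3 ≤ n) (hodd : Odd n) (A : Observable (polygon n) Ω) :
    Observable (polygon n) Ω :=
  Observable.ofNonneg (fun x => A.effect x (Pi.single 2 1) • LinearMap.proj 2)
    (fun x s hs => by
      have := (A.effect_mem x _ (centre_mem_polygon hn hodd)).1
      simpa [height_of_mem_polygon hs] using this)
    (fun s hs => by
      rw [← Finset.sum_smul, ← LinearMap.sum_apply, A.sum_eq_one _ (centre_mem_polygon hn hodd)]
      simp [height_of_mem_polygon hs])

theorem centreObservable_mem (hn : 3 ≤ n) (hodd : Odd n) (A : Observable (polygon n) Ω) :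
    centreObservable hn hodd A ∈ trivialObs (polygon n) Ω := by
  intro x s hs s' hs'
  simp [centreObservable, Observable.ofNonneg, height_of_mem_polygon hs,
    height_of_mem_polygon hs']

theorem le_noiseContent (hn : 3 ≤ n) (hodd : Odd n) {A : Observable (polygon n) Ω} {κ : ℝ}
    (hκ : 0 < κ) (h : ∀ x, ∀ s ∈ polygon n, (1 - κ) * A.effect x (Pi.single 2 1) ≤ A.effect x s) :
    1 - κ ≤ noiseContent A (trivialObs (polygon n) Ω) := by
  -- For `κ > 1` the bound is trivial; otherwise the centre distribution is split off with weight `1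
  -- - κ` and the remainder rescaled by `κ⁻¹`.
  rcases lt_or_ge (1 - κ) 0 with hneg | hnn
  · exact hneg.le.trans (Real.sSup_nonneg fun t ht => ht.1.1)
  refine le_csSup ⟨1, fun t ht => ht.1.2⟩ ⟨⟨hnn, by linarith⟩, _, centreObservable_mem hn hodd A,
    Observable.ofNonneg
      (fun x => κ⁻¹ • (A.effect x - ((1 - κ) * A.effect x (Pi.single 2 1)) • LinearMap.proj 2))
      ?_ ?_, ?_⟩
  · intro x s hs
    have := h x s hs
    have h2 := height_of_mem_polygon hs
    simp only [LinearMap.smul_apply, LinearMap.sub_apply, LinearMap.proj_apply, h2, smul_eq_mul]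
    have : 0 ≤ A.effect x s - (1 - κ) * A.effect x (Pi.single 2 1) * 1 := by linarith
    positivity
  · intro s hs
    rw [← Finset.smul_sum, Finset.sum_sub_distrib, ← Finset.sum_smul, ← Finset.mul_sum,
      ← LinearMap.sum_apply, A.sum_eq_one _ (centre_mem_polygon hn hodd)]
    simp only [LinearMap.smul_apply, LinearMap.sub_apply, A.sum_eq_one s hs, LinearMap.proj_apply,
      height_of_mem_polygon hs, smul_eq_mul]
    field_simp
    ring
  · intro x
    simp only [centreObservable, Observable.ofNonneg, sub_sub_cancel]
    rw [smul_inv_smul₀ hκ.ne', smul_smul]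
    abel

/-- The trivial part does not vary over the states, and the remaining part `(1 - t) • B` varies by
at most `1 - t`. -/
theorem effect_sub_le (hn : 3 ≤ n) (hodd : Odd n) (A : Observable (polygon n) Ω) (x : Ω)
    {s s' : Fin 3 → ℝ} (hs : s ∈ polygon n) (hs' : s' ∈ polygon n) :
    A.effect x s - A.effect x s' ≤ 1 - noiseContent A (trivialObs (polygon n) Ω) := by
  suffices noiseContent A (trivialObs (polygon n) Ω) ≤ 1 - (A.effect x s - A.effect x s') by
    linarith
  refine csSup_le ⟨0, ⟨le_rfl, zero_le_one⟩, _, centreObservable_mem hn hodd A, A, by simp⟩ ?_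
  rintro t ⟨⟨-, ht⟩, N, hN, B, hB⟩
  have h1 := (B.effect_mem x s hs).2
  have h2 := (B.effect_mem x s' hs').1
  have h3 := hN x s hs s' hs'
  rw [hB]
  simp only [LinearMap.add_apply, LinearMap.smul_apply, smul_eq_mul, h3]
  nlinarith

theorem noiseContent_ge_of_direction_bound (hn : 3 ≤ n) (hodd : Odd n)
    {A : Observable (polygon n) Ω} {κ : ℝ} (hκ : 0 < κ)
    (h : ∀ x (m : ℤ), -(polygonRadius n * (A.effect x (Pi.single 0 1) * cos (vertexAngle n m)
      + A.effect x (Pi.single 1 1) * sin (vertexAngle n m))) ≤ κ * A.effect x (Pi.single 2 1)) :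
    1 - κ ≤ noiseContent A (trivialObs (polygon n) Ω) := by
  refine le_noiseContent hn hodd hκ fun x => le_on_polygon _ _ fun m => ?_
  rw [dual_apply_polarPoint]
  have := h x m
  linarith

/-- Here some longest diagonal has its normal pointing exactly away from vertex `m`. -/
theorem noiseContent_ge_of_eq_add_three (hn : 3 ≤ n) (hodd : Odd n)
    {A : Observable (polygon n) Ω} (hA : A ∈ universallyCompatibleObs (polygon n) Ω)
    {l : ℕ} (hl : n = 4 * l + 3) :
    1 - polygonRadius n * sin (π / (2 * n)) ≤ noiseContent A (trivialObs (polygon n) Ω) := by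
  have hr := polygonRadius_pos hn
  have hs := sin_pi_div_two_mul_pos hn
  refine noiseContent_ge_of_direction_bound hn hodd (by positivity) fun x m => ?_
  have hn0 : (n : ℝ) ≠ 0 := Nat.cast_ne_zero.2 (by omega)
  have hln : (n : ℝ) = 4 * l + 3 := by exact_mod_cast hl
  have h := diagonal_bound hn hodd hA (m + l + 1) x (δ := vertexAngle n m + π) (by
    simp only [vertexAngle]
    push_cast
    field_simp
    rw [hln]; ring)
  rw [cos_add_pi, sin_add_pi] at h
  nlinarith

/-- Here the direction away from vertex `m` lies midway between two diagonal normals, each off by `π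
/ n`. Averaging their bounds costs a factor `1 / cos (π / n)`, the second power of `r`. -/
theorem noiseContent_ge_of_eq_add_one (hn : 3 ≤ n) (hodd : Odd n)
    {A : Observable (polygon n) Ω} (hA : A ∈ universallyCompatibleObs (polygon n) Ω)
    {l : ℕ} (hl : n = 4 * l + 1) :
    1 - polygonRadius n ^ 2 * sin (π / (2 * n)) ≤ noiseContent A (trivialObs (polygon n) Ω) := by
  have hr := polygonRadius_pos hn
  have hrc := polygonRadius_mul_cos hn
  have hs := sin_pi_div_two_mul_pos hn
  refine noiseContent_ge_of_direction_bound hn hodd (by positivity) fun x m => ?_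
  have hn0 : (n : ℝ) ≠ 0 := Nat.cast_ne_zero.2 (by omega)
  have hln : (n : ℝ) = 4 * l + 1 := by exact_mod_cast hl
  have h1 := diagonal_bound hn hodd hA (m + l) x (δ := vertexAngle n m - π / n + π) (by
    simp only [vertexAngle]
    push_cast
    field_simp
    rw [hln]; ring)
  have h2 := diagonal_bound hn hodd hA (m + l + 1) x (δ := vertexAngle n m + π / n + π) (by
    simp only [vertexAngle]
    push_cast
    field_simp
    rw [hln]; ring)
  rw [cos_add_pi, sin_add_pi, cos_sub, sin_sub] at h1
  rw [cos_add_pi, sin_add_pi, cos_add, sin_add] at h2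
  set θ := vertexAngle n m
  set X := A.effect x (Pi.single 0 1)
  set Y := A.effect x (Pi.single 1 1)
  set Z := A.effect x (Pi.single 2 1)
  have h3 : -(cos (π / n) * (X * cos θ + Y * sin θ)) ≤ sin (π / (2 * n)) * Z := by linarith
  have h4 := mul_le_mul_of_nonneg_left h3 (sq_nonneg (polygonRadius n))
  have e : polygonRadius n ^ 2 * -(cos (π / n) * (X * cos θ + Y * sin θ))
      = -(polygonRadius n * (X * cos θ + Y * sin θ)) := by
    linear_combination -(polygonRadius n * (X * cos θ + Y * sin θ)) * hrc
  linarith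

end Noise

/-! ### Width of the polygon and construction of the joint observable. -/

section Sufficient

variable {n : ℕ}

/-- The longest diagonals point in the directions `(k + 1/2) π / n`; the parity of `k` decides which
end of the opposite edge is used and the orientation. -/
theorem exists_vertex_pair (hn : 3 ≤ n) (hodd : Odd n) (k : ℤ) :
    ∃ m m' : ℤ, cos (vertexAngle n m) - cos (vertexAngle n m')
        = 2 * cos (π / (2 * n)) * cos ((k + 1 / 2) * (π / n)) ∧
      sin (vertexAngle n m) - sin (vertexAngle n m')
        = 2 * cos (π / (2 * n)) * sin ((k + 1 / 2) * (π / n)) := by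
  have hn0 : (n : ℝ) ≠ 0 := Nat.cast_ne_zero.2 (by omega)
  obtain ⟨l, hl⟩ := hodd
  have hln : (n : ℝ) = 2 * l + 1 := by exact_mod_cast hl
  set ε := π / (2 * n) with hε
  have he : π / n = 2 * ε := by rw [hε]; ring
  set ψ := (k + 1 / 2) * (π / n) with hψ
  have hang : ∀ m : ℤ, vertexAngle n m = 2 * m * (π / n) := by
    intro m; simp only [vertexAngle]; ring
  have hnn : (2 * l + 1) * (π / n) = π := by rw [← hln]; field_simp
  rcases Int.even_or_odd' k with ⟨j, hj | hj⟩
  · refine ⟨j, j + l + 1, ?_⟩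
    have hk : (k : ℝ) = 2 * j := by exact_mod_cast hj
    have e1 : vertexAngle n j = ψ - ε := by rw [hang, hψ, he, hk]; ring
    have e2 : vertexAngle n (j + l + 1) = ψ + ε + π := by
      rw [hang, hψ]; push_cast; linear_combination hnn + he / 2 - π / n * hk
    rw [e1, e2, cos_add_pi, sin_add_pi, cos_add, cos_sub, sin_add, sin_sub]
    constructor <;> ring
  · refine ⟨j + 1, j + l + 1, ?_⟩
    have hk : (k : ℝ) = 2 * j + 1 := by exact_mod_cast hj
    have e1 : vertexAngle n (j + 1) = ψ + ε := by rw [hang, hψ, he, hk]; push_cast; ring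
    have e2 : vertexAngle n (j + l + 1) = ψ - ε + π := by
      rw [hang, hψ]; push_cast; linear_combination hnn - he / 2 - π / n * hk
    rw [e1, e2, cos_add_pi, sin_add_pi, cos_add, cos_sub, sin_add, sin_sub]
    constructor <;> ring

/-- The width of the polygon is at least `1 + r` in every direction. -/
theorem exists_width_ge (hn : 3 ≤ n) (hodd : Odd n) (g : Module.Dual ℝ (Fin 3 → ℝ)) :
    ∃ s ∈ polygon n, ∃ s' ∈ polygon n,
      √(g (Pi.single 0 1) ^ 2 + g (Pi.single 1 1) ^ 2) * (1 + polygonRadius n) ≤ g s - g s' := by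
  have hn0 : n ≠ 0 := by omega
  have hε := pi_div_pos hn
  have hε3 := pi_div_le hn
  have hr := polygonRadius_pos hn
  have hrc := polygonRadius_mul_cos hn
  set x := g (Pi.single 0 1) with hx
  set y := g (Pi.single 1 1) with hy
  obtain ⟨ψ, hxψ, hyψ⟩ : ∃ ψ, x = √(x ^ 2 + y ^ 2) * cos ψ ∧ y = √(x ^ 2 + y ^ 2) * sin ψ := by
    refine ⟨Complex.arg ⟨x, y⟩, ?_, ?_⟩
    · have := Complex.norm_mul_cos_arg ⟨x, y⟩
      rw [Complex.norm_eq_sqrt_sq_add_sq] at this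
      exact this.symm
    · have := Complex.norm_mul_sin_arg ⟨x, y⟩
      rw [Complex.norm_eq_sqrt_sq_add_sq] at this
      exact this.symm
  set ρ := √(x ^ 2 + y ^ 2) with hρ
  have hρ0 : 0 ≤ ρ := sqrt_nonneg _
  -- The diagonal direction `(k + 1/2) π / n` is within `π / (2n)` of `ψ`.
  set k := ⌊ψ / (π / n)⌋
  have hk1 : k * (π / n) ≤ ψ := (le_div_iff₀ hε).1 (Int.floor_le _)
  have hk2 : ψ < (k + 1) * (π / n) := (div_lt_iff₀ hε).1 (Int.lt_floor_add_one _)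
  obtain ⟨m, m', hc, hs⟩ := exists_vertex_pair hn hodd k
  refine ⟨_, vertex_mem_polygon hn0 m, _, vertex_mem_polygon hn0 m', ?_⟩
  have e2 : π / (2 * n) = π / n / 2 := by ring
  set C := cos (π / (2 * n)) with hC
  have hCpos : 0 < C := cos_pos_of_mem_Ioo ⟨by rw [e2]; linarith [pi_pos],
    by rw [e2]; linarith [pi_pos]⟩
  have hcos : C ≤ cos (ψ - (k + 1 / 2) * (π / n)) := by
    rw [← cos_abs (ψ - _)]
    refine cos_le_cos_of_nonneg_of_le_pi (abs_nonneg _) (by rw [e2]; linarith [pi_pos]) ?_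
    rw [abs_le, e2]
    constructor <;> linarith
  have hC2 : 2 * C ^ 2 = 1 + cos (π / n) := by
    have : π / n = 2 * (π / (2 * n)) := by ring
    rw [this, cos_two_mul]; ring
  rw [dual_apply_polarPoint, dual_apply_polarPoint, ← hx, ← hy]
  calc ρ * (1 + polygonRadius n) = polygonRadius n * ρ * (2 * C) * C := by
        linear_combination -ρ * hrc - polygonRadius n * ρ * hC2
    _ ≤ polygonRadius n * ρ * (2 * C) * cos (ψ - (k + 1 / 2) * (π / n)) := by gcongr
    _ = polygonRadius n * (x * (cos (vertexAngle n m) - cos (vertexAngle n m'))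
          + y * (sin (vertexAngle n m) - sin (vertexAngle n m'))) := by
        rw [hc, hs, hxψ, hyψ, cos_sub]; ring
    _ = _ := by ring

theorem mem_universallyCompatibleObs {Ω : Type*} [Fintype Ω] (hn : 3 ≤ n) (hodd : Odd n)
    {A : Observable (polygon n) Ω}
    (hA : ∀ x, A.effect x (Pi.single 0 1) ^ 2 + A.effect x (Pi.single 1 1) ^ 2
      ≤ (sin (π / (2 * n)) * A.effect x (Pi.single 2 1)) ^ 2) :
    A ∈ universallyCompatibleObs (polygon n) Ω := by
  intro Ω' _ B
  have hb : ∀ y, IsConic n (B.effect y) := fun y =>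
    isConic_of_nonneg hn hodd fun s hs => (B.effect_mem y s hs).1
  choose b hb0 hbB using hb
  set β : Fin n → ℝ := fun k => ∑ y, b y k with hβ
  have hβ0 : ∀ k, 0 ≤ β k := fun k => Finset.sum_nonneg fun y _ => hb0 y k
  have hunit : ∑ k : Fin n, β k • rayEffect (vertexAngle n (k : ℕ)) = LinearMap.proj 2 := by
    rw [← sum_effect_eq_proj hn hodd B]
    simp only [hbB, hβ, Finset.sum_smul]
    exact Finset.sum_comm
  have hat : ∀ v, ∑ k : Fin n, β k * rayEffect (vertexAngle n (k : ℕ)) v = v 2 := by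
    intro v
    have := congrArg (fun f => f v) hunit
    simpa [LinearMap.sum_apply] using this
  have h1 : ∑ k, β k = 1 := by
    have := hat (Pi.single 2 1)
    simpa [rayEffect_single_two] using this
  obtain ⟨q, hq0, hq1, hq2⟩ := exists_distribution hn hodd (sum_effect_eq_proj hn hodd A)
    (fun x => (A.effect_mem x _ (centre_mem_polygon hn hodd)).1) hA _ β le_rfl hβ0
    (by simpa [rayEffect_single_zero] using hat (Pi.single 0 1))
    (by simpa [rayEffect_single_one] using hat (Pi.single 1 1))
  have hq0' : ∀ k x, β k = 0 → q k x = 0 := by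
    intro k x h
    have h3 := hq1 k
    rw [h, Finset.sum_eq_zero_iff_of_nonneg fun x _ => hq0 k x] at h3
    exact h3 x (Finset.mem_univ x)
  have hb0' : ∀ k y, β k = 0 → b y k = 0 := by
    intro k y h
    rw [hβ] at h
    exact (Finset.sum_eq_zero_iff_of_nonneg fun y _ => hb0 y k).1 h y (Finset.mem_univ y)
  -- Given the ray `k`, the two outcomes are drawn independently. Where `β k = 0` the quotient is
  -- `0` by convention, which is right since `q` and `b` vanish there.
  refine compatible_of_joint
    (fun x y => ∑ k : Fin n, (q k x * b y k / β k) • rayEffect (vertexAngle n (k : ℕ))) ?_ ?_ ?_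
  · intro x y s hs
    rw [LinearMap.sum_apply]
    refine Finset.sum_nonneg fun k _ => ?_
    exact mul_nonneg (div_nonneg (mul_nonneg (hq0 k x) (hb0 y k)) (hβ0 k))
      (rayEffect_nonneg hn hodd _ s hs)
  · intro x
    rw [Finset.sum_comm]
    have := hq2 x
    rw [h1, one_smul] at this
    rw [← this]
    refine Finset.sum_congr rfl fun k _ => ?_
    rw [← Finset.sum_smul, ← Finset.sum_div, ← Finset.mul_sum]
    congr 1
    change q k x = q k x * β k / β k
    by_cases h : β k = 0
    · simp [hq0' k x h]
    · field_simp
  · intro y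
    rw [Finset.sum_comm, hbB]
    refine Finset.sum_congr rfl fun k _ => ?_
    rw [← Finset.sum_smul, ← Finset.sum_div, ← Finset.sum_mul, hq1]
    congr 1
    by_cases h : β k = 0
    · simp [hb0' k y h]
    · field_simp

end Sufficient

end GPT

theorem mainTheorem10 {n : ℕ} (hn : 3 ≤ n) (hodd : Odd n) {Ω : Type*} [Fintype Ω]
    (A : GPT.Observable (GPT.polygon n) Ω) :
    (A ∈ GPT.universallyCompatibleObs (GPT.polygon n) Ω →
      ((∃ l : ℕ, n = 4 * l + 3) →
        GPT.noiseContent A (GPT.trivialObs (GPT.polygon n) Ω) ≥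
          1 - GPT.polygonRadius n * Real.sin (Real.pi / (2 * n))) ∧
      ((∃ l : ℕ, n = 4 * l + 1) →
        GPT.noiseContent A (GPT.trivialObs (GPT.polygon n) Ω) ≥
          1 - GPT.polygonRadius n ^ 2 * Real.sin (Real.pi / (2 * n)))) ∧
    (∀ (α : Ω → ℝ) (a : Ω → Fin 2 → ℝ),
      (∀ x, 0 < α x) →
      (∀ x, ∀ v : Fin 3 → ℝ,
        A.effect x v = (α x • ![a x 0, a x 1, GPT.polygonHeight n]) ⬝ᵥ v) →
      (1 - GPT.noiseContent A (GPT.trivialObs (GPT.polygon n) Ω)) / (⨅ x, α x) ≤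
        Real.sin (Real.pi / (2 * n)) →
      A ∈ GPT.universallyCompatibleObs (GPT.polygon n) Ω) := by
  refine ⟨fun hA => ⟨fun ⟨l, hl⟩ => GPT.noiseContent_ge_of_eq_add_three hn hodd hA hl,
    fun ⟨l, hl⟩ => GPT.noiseContent_ge_of_eq_add_one hn hodd hA hl⟩, ?_⟩
  intro α a hα hAα hw
  refine GPT.mem_universallyCompatibleObs hn hodd fun x => ?_
  -- Nonemptiness makes the infimum an attained, hence positive, minimum.
  have : Nonempty Ω := ⟨x⟩
  obtain ⟨x₀, hx₀⟩ := exists_eq_ciInf_of_finite (f := α)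
  have hmin : (⨅ x, α x) ≤ α x := ciInf_le (Set.finite_range α).bddBelow x
  rw [div_le_iff₀ (by rw [← hx₀]; exact hα x₀)] at hw
  have hs := GPT.sin_pi_div_two_mul_pos hn
  have hr := GPT.polygonRadius_pos hn
  have hz : A.effect x (Pi.single 2 1) = α x * GPT.polygonHeight n := by
    rw [hAα]; simp
  obtain ⟨s, hs1, s', hs2, hle⟩ := GPT.exists_width_ge hn hodd (A.effect x)
  have hgap := GPT.effect_sub_le hn hodd A x hs1 hs2
  have hfin := mul_le_mul_of_nonneg_left hmin hs.le
  rw [hz, GPT.polygonHeight]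
  refine (Real.sqrt_le_left (by have := hα x; positivity)).1 ?_
  rw [mul_one_div, mul_div_assoc', le_div_iff₀ (by positivity)]
  linarith
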